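/- Let $d \in \mathbb N_0$. For a multiindex $\beta = (\beta_1,\dots,\beta_d) \in \mathbb N_0^d$ write $\partial^\beta = \frac{\partial^{\beta_1}}{\partial x_1^{\beta_1}} \cdots \frac{\partial^{\beta_d}}{\partial x_d^{\beta_d}}$. For $\gamma \in (\mathbb N_0 \cup \{\infty\})^d$ write $\beta \le \gamma$ if $\beta_i \le \gamma_i$ for all $i$, and let $\mathcal C^\gamma(\mathbb R^d)$ be the set of functions $f : \mathbb R^d \to \mathbb R$ such that, for every multiindex $\beta \le \gamma$, the derivative $\partial^\beta f$ exists and is continuous on $\mathbb R^d$. 1. Let $\gamma \in (\mathbb N_0 \cup \{\infty\})^d$ and $f \in \mathcal C^\gamma(\mathbb R^d)$. Then there is one sequence $(q_n)_{n \in \mathbb N}$ of polynomials in $d$ variables with rational coefficients such that, for every multiindex $\beta \le \gamma$, $\partial^\beta q_n \to \partial^\beta f$ locally uniformly on $\mathbb R^d$ as $n \to \infty$. 2. In particular, if $f : \mathbb R^d \to \mathbb R$ is smooth, then there is one sequence $(q_n)_{n \in \mathbb N}$ of polynomials in $d$ variables with rational coefficients such that, for every compact $K \subset \mathbb R^d$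 and every multiindex $\beta \in \mathbb N_0^d$, $\partial^\beta q_n \to \partial^\beta f$ uniformly on $K$ as $n \to \infty$. -/

import Mathlib

open Filter Topology
open scoped ContDiff

/-!  Points of `ℝ^d` are functions `Fin d → ℝ`; only the topology and the uniform structure of
`ℝ^d` matter below, and these do not depend on the choice of a norm. -/

/-- The partial derivative `∂f/∂x_i : ℝ^d → ℝ` (with the junk value `0` where it does not exist). -/
noncomputable def partialDeriv {d : ℕ} (i : Fin d) (f : (Fin d → ℝ) → ℝ) : (Fin d → ℝ) → ℝ :=
  fun x => lineDeriv ℝ f x (Pi.single i 1)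

/-- The iterated partial derivative `∂_{i₁} (∂_{i₂} (⋯ (∂_{i_k} f)))` along a list `[i₁, …, i_k]` of
coordinate directions. -/
noncomputable def partialDerivList {d : ℕ} (f : (Fin d → ℝ) → ℝ) :
    List (Fin d) → ((Fin d → ℝ) → ℝ)
  | [] => f
  | i :: w => partialDeriv i (partialDerivList f w)

/-- `∂_{i₁} (∂_{i₂} (⋯ (∂_{i_k} f)))` exists everywhere on `ℝ^d`: every one of the successive partial
derivatives exists at every point. -/
def PartialDerivListExists {d : ℕ} (f : (Fin d → ℝ) → ℝ) : List (Fin d) → Prop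
  | [] => True
  | i :: w => PartialDerivListExists f w ∧
      ∀ x : Fin d → ℝ, LineDifferentiableAt ℝ (partialDerivList f w) x (Pi.single i 1)

/-- The list `[0, …, 0, 1, …, 1, …, d-1, …, d-1]` in which the coordinate `i` occurs `β i` times. -/
def multiIndexList {d : ℕ} (β : Fin d → ℕ) : List (Fin d) :=
  (List.finRange d).flatMap fun i => List.replicate (β i) i

/-- `∂^β f = (∂/∂x₁)^{β₁} ⋯ (∂/∂x_d)^{β_d} f` for a multiindex `β`. -/
noncomputable def multiPartialDeriv {d : ℕ} (β : Fin d → ℕ) (f : (Fin d → ℝ) → ℝ) :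
    (Fin d → ℝ) → ℝ :=
  partialDerivList f (multiIndexList β)

/-- The class `C^γ(ℝ^d)`, where the entries of `γ` may be infinite: for every multiindex `β ≤ γ` the
derivative `∂^β f` exists on `ℝ^d` and is continuous. -/
def IsCMulti {d : ℕ} (γ : Fin d → ℕ∞) (f : (Fin d → ℝ) → ℝ) : Prop :=
  ∀ β : Fin d → ℕ, (∀ i, (β i : ℕ∞) ≤ γ i) →
    PartialDerivListExists f (multiIndexList β) ∧ Continuous (multiPartialDeriv β f)

/-- The function `ℝ^d → ℝ` given by a polynomial with rational coefficients. -/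
noncomputable def ratPolyFun {d : ℕ} (q : MvPolynomial (Fin d) ℚ) : (Fin d → ℝ) → ℝ :=
  fun x => MvPolynomial.aeval x q

/-! Mollification reduces `f ∈ C^γ` to a smooth function and a cutoff reduces that to a smooth
compactly supported `g`. Such a `g` is the limit, with all its derivatives, of `ψ ⋆ g` for bump
functions `ψ` of shrinking support. Since `∂^β (k ⋆ g) = k ⋆ ∂^β g` depends continuously on the
continuous function `k`, Stone–Weierstrass lets one replace `ψ` by a polynomial `p`, and `p ⋆ g` is
again a polynomial. -/

open MeasureTheory Metric Set MvPolynomial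
open scoped Convolution

section ContinuousMap

variable {X Y : Type*} [TopologicalSpace X]

lemma tendsto_continuousMap_of_tendsto_prod_nhds [UniformSpace Y] {ι : Type*} {l : Filter ι}
    {F : ι → C(X, Y)} {f : C(X, Y)}
    (h : ∀ x, Tendsto (fun p : ι × X => F p.1 p.2) (l ×ˢ 𝓝 x) (𝓝 (f x))) :
    Tendsto F l (𝓝 f) :=
  ContinuousMap.tendsto_of_tendstoLocallyUniformly <|
    tendstoLocallyUniformly_iff_forall_tendsto.2 fun x =>
      (((f.continuous.tendsto x).comp tendsto_snd).prodMk_nhds (h x)).mono_right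
        (nhds_le_uniformity (f x))

lemma dense_of_separatesPoints {A : Subalgebra ℝ C(X, ℝ)} (hA : A.SeparatesPoints) :
    Dense (A : Set C(X, ℝ)) := by
  intro f
  refine (mem_closure_iff_nhds_basis
    (nhds_basis_uniformity' uniformity_basis_dist.compactConvergenceUniformity)).2 ?_
  rintro ⟨K, ε⟩ ⟨hK, hε⟩
  obtain ⟨g, hgA, hg⟩ :=
    ContinuousMap.exists_mem_subalgebra_near_continuous_of_isCompact_of_separatesPoints hA f hK hε
  refine ⟨g, hgA, fun x hx => ?_⟩
  change dist (f x) (g x) < ε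
  rw [dist_comm, dist_eq_norm]
  exact hg x hx

end ContinuousMap

section Polynomial

variable {σ : Type*}

/-- The algebra homomorphism sending a real polynomial to the continuous function on `ℝ^σ` which it
defines. -/
noncomputable def mvPolynomialToContinuousMap : MvPolynomial σ ℝ →ₐ[ℝ] C(σ → ℝ, ℝ) :=
  aeval fun i => ⟨fun x => x i, continuous_apply i⟩

lemma mvPolynomialToContinuousMap_apply (p : MvPolynomial σ ℝ) (x : σ → ℝ) :
    mvPolynomialToContinuousMap p x = aeval x p :=
  comp_aeval_apply _ (ContinuousMap.evalAlgHom ℝ ℝ x) p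

lemma dense_range_mvPolynomialToContinuousMap :
    Dense (range (mvPolynomialToContinuousMap (σ := σ))) := by
  rw [← AlgHom.coe_range]
  refine dense_of_separatesPoints fun x y hxy => ?_
  obtain ⟨i, hi⟩ := Function.ne_iff.1 hxy
  exact ⟨_, ⟨_, ⟨X i, rfl⟩, rfl⟩, by simpa [mvPolynomialToContinuousMap_apply] using hi⟩

lemma map_mem_closure_range_map_rat {E : Type*} [AddCommMonoid E] [Module ℝ E]
    [TopologicalSpace E] [ContinuousAdd E] [ContinuousSMul ℝ E]
    (J : MvPolynomial σ ℝ →ₗ[ℝ] E) (p : MvPolynomial σ ℝ) :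
    J p ∈ closure (range fun q : MvPolynomial σ ℚ => J (q.map (algebraMap ℚ ℝ))) := by
  induction p using MvPolynomial.induction_on' with
  | monomial u a =>
    have hmonomial (c : ℝ) : J (monomial u c) = c • J (monomial u 1) := by
      rw [← map_smul, smul_monomial, smul_eq_mul, mul_one]
    rw [hmonomial]
    refine map_mem_closure (f := fun c : ℝ => c • J (monomial u 1)) (by fun_prop)
      (Rat.denseRange_cast a) ?_
    rintro _ ⟨c, rfl⟩
    refine ⟨monomial u c, ?_⟩
    beta_reduce
    rw [map_monomial, hmonomial, eq_ratCast]
  | add p q hp hq =>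
    rw [map_add]
    refine map_mem_closure₂ continuous_add hp hq ?_
    rintro _ ⟨p', rfl⟩ _ ⟨q', rfl⟩
    exact ⟨p' + q', by simp only [map_add]⟩

/-- The composition `∂_{i₁} ∘ ⋯ ∘ ∂_{i_k}` of formal partial derivatives along `[i₁, …, i_k]`. -/
noncomputable def pderivList {R : Type*} [CommSemiring R] (w : List σ) :
    MvPolynomial σ R →ₗ[R] MvPolynomial σ R :=
  (w.map fun i => (pderiv i : Derivation R (MvPolynomial σ R) _).toLinearMap).prod

end Polynomial

section Convolution

lemma continuous_convolution_apply {G E E' F : Type*} [AddCommGroup G] [TopologicalSpace G]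
    [IsTopologicalAddGroup G] [LocallyCompactSpace G] [MeasurableSpace G] [BorelSpace G]
    {μ : Measure G} [μ.IsAddLeftInvariant] [μ.IsNegInvariant] [IsFiniteMeasureOnCompacts μ]
    [NormedAddCommGroup E] [NormedSpace ℝ E] [NormedAddCommGroup E'] [NormedSpace ℝ E']
    [NormedAddCommGroup F] [NormedSpace ℝ F] (L : E →L[ℝ] E' →L[ℝ] F) {g : G → E'}
    (hs : HasCompactSupport g) (hg : Continuous g) :
    Continuous fun q : C(G, E) × G => (q.1 ⋆[L, μ] g) q.2 := by
  simp only [convolution_eq_swap]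
  rw [← continuousOn_univ]
  refine continuousOn_integral_of_compact_support hs (by fun_prop) fun q y _ hy => ?_
  rw [image_eq_zero_of_notMem_tsupport hy, map_zero]

lemma hasLineDerivAt_convolution_right {G E E' F : Type*} [NormedAddCommGroup G] [NormedSpace ℝ G]
    [MeasurableSpace G] [OpensMeasurableSpace G] {μ : Measure G} [IsFiniteMeasureOnCompacts μ]
    [NormedAddCommGroup E] [NormedSpace ℝ E] [NormedAddCommGroup E'] [NormedSpace ℝ E']
    [NormedAddCommGroup F] [NormedSpace ℝ F] (L : E →L[ℝ] E' →L[ℝ] F) {φ : G → E} {g g' : G → E'}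
    (hs : HasCompactSupport φ) (hφ : Continuous φ) (hg : Continuous g) (hg' : Continuous g')
    {v : G} (hgg' : ∀ x, HasLineDerivAt ℝ g (g' x) x v) (x : G) :
    HasLineDerivAt ℝ (φ ⋆[L, μ] g) ((φ ⋆[L, μ] g') x) x v := by
  have hK : IsCompact ((fun p : ℝ × G => x + p.1 • v - p.2) '' (closedBall 0 1 ×ˢ tsupport φ)) :=
    ((isCompact_closedBall _ _).prod hs).image (by fun_prop)
  obtain ⟨C, hC⟩ := hK.exists_bound_of_continuousOn hg'.continuousOn
  have hint (k : G → E') (hk : Continuous k) (t : ℝ) :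
      Integrable (fun y => L (φ y) (k (x + t • v - y))) μ := by
    refine Continuous.integrable_of_hasCompactSupport (by fun_prop) (hs.mono fun y => ?_)
    contrapose
    simp +contextual
  have hbound : ∀ t ∈ ball (0 : ℝ) 1, ∀ y, ‖L (φ y) (g' (x + t • v - y))‖ ≤ ‖L‖ * ‖φ y‖ * C := by
    intro t ht y
    by_cases hy : y ∈ tsupport φ
    · have hCy : ‖g' (x + t • v - y)‖ ≤ C := hC _ ⟨(t, y), ⟨ball_subset_closedBall ht, hy⟩, rfl⟩
      exact (L.le_opNorm₂ _ _).trans (by gcongr)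
    · simp [image_eq_zero_of_notMem_tsupport hy]
  have hderiv (t : ℝ) (y : G) :
      HasDerivAt (fun s : ℝ => g (x + s • v - y)) (g' (x + t • v - y)) t := by
    have hshift :
        HasDerivAt (fun s : ℝ => g (x + t • v - y + s • v)) (g' (x + t • v - y)) (t - t) :=
      (sub_self t).symm ▸ hgg' _
    refine (hshift.comp_sub_const t t).congr_of_eventuallyEq (.of_forall fun s => congrArg g ?_)
    module
  have hmain := (hasDerivAt_integral_of_dominated_loc_of_deriv_le (ball_mem_nhds (0 : ℝ) one_pos)
    (.of_forall fun t => (hint g hg t).aestronglyMeasurable) (hint g hg 0)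
    (hint g' hg' 0).aestronglyMeasurable (.of_forall fun y t ht => hbound t ht y)
    (((hφ.norm.integrable_of_hasCompactSupport hs.norm).const_mul _).mul_const C)
    (.of_forall fun y t _ => (L (φ y)).hasFDerivAt.comp_hasDerivAt t (hderiv t y))).2
  simpa [HasLineDerivAt, convolution_def] using hmain

end Convolution

section PartialDeriv

variable {d : ℕ} {f g : (Fin d → ℝ) → ℝ}

lemma partialDeriv_eq_fderiv (hf : Differentiable ℝ f) (i : Fin d) :
    partialDeriv i f = fun x => fderiv ℝ f x (Pi.single i 1) :=
  funext fun x => (hf x).lineDeriv_eq_fderiv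

lemma contDiff_partialDerivList (hf : ContDiff ℝ ∞ f) (w : List (Fin d)) :
    ContDiff ℝ ∞ (partialDerivList f w) := by
  induction w with
  | nil => exact hf
  | cons i w ih =>
    rw [partialDerivList, partialDeriv_eq_fderiv (ih.differentiable (by simp))]
    exact (ih.fderiv_right (m := ∞) (by simp)).clm_apply contDiff_const

lemma differentiable_partialDerivList (hf : ContDiff ℝ ∞ f) (w : List (Fin d)) :
    Differentiable ℝ (partialDerivList f w) :=
  (contDiff_partialDerivList hf w).differentiable (by simp)

lemma partialDerivListExists_of_contDiff (hf : ContDiff ℝ ∞ f) (w : List (Fin d)) :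
    PartialDerivListExists f w := by
  induction w with
  | nil => trivial
  | cons i w ih =>
    exact ⟨ih, fun x => (differentiable_partialDerivList hf w x).lineDifferentiableAt⟩

lemma partialDerivList_eventuallyEq {x : Fin d → ℝ} (h : f =ᶠ[𝓝 x] g) (w : List (Fin d)) :
    partialDerivList f w =ᶠ[𝓝 x] partialDerivList g w := by
  induction w with
  | nil => exact h
  | cons i w ih => exact ih.eventuallyEq_nhds.mono fun y hy => hy.lineDeriv_eq

lemma hasCompactSupport_partialDerivList (hs : HasCompactSupport f) (hf : ContDiff ℝ ∞ f)
    (w : List (Fin d)) : HasCompactSupport (partialDerivList f w) := by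
  induction w with
  | nil => exact hs
  | cons i w ih =>
    rw [partialDerivList, partialDeriv_eq_fderiv (differentiable_partialDerivList hf w)]
    exact ih.fderiv_apply ℝ _

lemma partialDerivList_convolution_of_hasCompactSupport_left (hs : HasCompactSupport f)
    (hf : Continuous f) (w : List (Fin d)) (hex : PartialDerivListExists g w)
    (hc : ∀ u, u <:+ w → Continuous (partialDerivList g u)) :
    partialDerivList (f ⋆ g) w = f ⋆ partialDerivList g w := by
  induction w with
  | nil => rfl
  | cons i w ih =>
    have hsuffix := List.suffix_cons i w
    rw [partialDerivList, ih hex.1 fun u hu => hc u (hu.trans hsuffix)]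
    exact funext fun x => (hasLineDerivAt_convolution_right _ hs hf (hc w hsuffix)
      (hc (i :: w) List.suffix_rfl) (fun y => (hex.2 y).hasLineDerivAt) x).lineDeriv

lemma partialDerivList_convolution_of_hasCompactSupport_right (hf : LocallyIntegrable f)
    (hs : HasCompactSupport g) (hg : ContDiff ℝ ∞ g) (w : List (Fin d)) :
    partialDerivList (f ⋆ g) w = f ⋆ partialDerivList g w := by
  induction w with
  | nil => rfl
  | cons i w ih =>
    have hgw : ContDiff ℝ 1 (partialDerivList g w) :=
      (contDiff_partialDerivList hg w).of_le (by simp)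
    have hsw := hasCompactSupport_partialDerivList hs hg w
    rw [partialDerivList, ih, partialDerivList,
      partialDeriv_eq_fderiv (differentiable_partialDerivList hg w)]
    refine funext fun x => ((hsw.hasFDerivAt_convolution_right (ContinuousLinearMap.lsmul ℝ ℝ)
      hf hgw x).hasLineDerivAt _).lineDeriv.trans ?_
    exact convolution_precompR_apply _ hf (hsw.fderiv ℝ) (hgw.continuous_fderiv one_ne_zero) x _

lemma contDiff_aeval {R : Type*} [CommSemiring R] [Algebra R ℝ] (p : MvPolynomial (Fin d) R) :
    ContDiff ℝ ∞ fun x : Fin d → ℝ => aeval x p := by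
  have hproj (i : Fin d) : AnalyticOnNhd ℝ (fun x : Fin d → ℝ => x i) univ :=
    (ContinuousLinearMap.proj (R := ℝ) (φ := fun _ : Fin d => ℝ) i).analyticOnNhd univ
  exact (AnalyticOnNhd.aeval_mvPolynomial hproj p).contDiff

lemma hasLineDerivAt_aeval {R : Type*} [CommSemiring R] [Algebra R ℝ] (p : MvPolynomial (Fin d) R)
    (i : Fin d) (x : Fin d → ℝ) :
    HasLineDerivAt ℝ (fun y => aeval y p) (aeval x (pderiv i p)) x (Pi.single i 1) := by
  unfold HasLineDerivAt
  induction p using MvPolynomial.induction_on with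
  | C a => simpa using hasDerivAt_const (0 : ℝ) (algebraMap R ℝ a)
  | add p q hp hq => simpa using hp.fun_add hq
  | mul_X p j hp =>
    have hX : HasDerivAt (fun t : ℝ => (x + t • Pi.single i 1 : Fin d → ℝ) j)
        ((Pi.single i 1 : Fin d → ℝ) j) 0 := by
      simpa using ((hasDerivAt_id (0 : ℝ)).mul_const _).const_add (x j)
    have hpderiv : aeval x (pderiv i (p * X j)) =
        aeval x (pderiv i p) * x j + aeval x p * (Pi.single i 1 : Fin d → ℝ) j := by
      rcases eq_or_ne j i with rfl | hji
      · simp [add_comm, mul_comm]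
      · simp [pderiv_X_of_ne hji, hji, mul_comm]
    rw [hpderiv]
    simpa using hp.fun_mul hX

lemma partialDerivList_aeval {R : Type*} [CommSemiring R] [Algebra R ℝ]
    (p : MvPolynomial (Fin d) R) (w : List (Fin d)) :
    partialDerivList (fun x => aeval x p) w = fun x => aeval x (pderivList w p) := by
  induction w with
  | nil => rfl
  | cons i w ih =>
    rw [partialDerivList, ih]
    exact funext fun x => (hasLineDerivAt_aeval _ i x).lineDeriv

end PartialDeriv

lemma exists_aeval_eq_convolution {σ : Type*} [Fintype σ] (p : MvPolynomial σ ℝ) {g : (σ → ℝ) → ℝ}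
    (hs : HasCompactSupport g) (hg : Continuous g) :
    ∃ r : MvPolynomial σ ℝ, ((fun x => aeval x p) ⋆ g) = fun x => aeval x r := by
  have hint (q : MvPolynomial σ ℝ) {k : (σ → ℝ) → ℝ} (hs : HasCompactSupport k)
      (hk : Continuous k) (x : σ → ℝ) : Integrable fun y => aeval (x - y) q * k y := by
    refine Continuous.integrable_of_hasCompactSupport (.mul ?_ hk) hs.mul_left
    simp only [← mvPolynomialToContinuousMap_apply]
    fun_prop
  simp only [_root_.funext_iff, convolution_lsmul_swap, smul_eq_mul]
  induction p using MvPolynomial.induction_on generalizing g with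
  | C a => exact ⟨C (∫ y, a * g y), fun x => by simp⟩
  | add p q hp hq =>
    obtain ⟨r, hr⟩ := hp hs hg
    obtain ⟨s, hs'⟩ := hq hs hg
    refine ⟨r + s, fun x => ?_⟩
    simp only [map_add, add_mul]
    rw [integral_add (hint p hs hg x) (hint q hs hg x), hr, hs']
  | mul_X p i hp =>
    have hsi : HasCompactSupport fun y : σ → ℝ => y i * g y := hs.mul_left
    have hgi : Continuous fun y : σ → ℝ => y i * g y := (continuous_apply i).mul hg
    obtain ⟨r, hr⟩ := hp hs hg
    obtain ⟨s, hs'⟩ := hp hsi hgi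
    refine ⟨X i * r - s, fun x => ?_⟩
    have hexpand (y : σ → ℝ) : aeval (x - y) (p * X i) * g y =
        x i * (aeval (x - y) p * g y) - aeval (x - y) p * (y i * g y) := by
      simp only [map_mul, aeval_X, Pi.sub_apply]
      ring
    simp only [hexpand]
    rw [integral_sub ((hint p hs hg x).const_mul _) (hint p hsi hgi x), integral_const_mul, hr, hs']
    simp only [map_sub, map_mul, aeval_X]

section MultiIndexList

variable {d : ℕ}

lemma count_multiIndexList (β : Fin d → ℕ) (i : Fin d) : (multiIndexList β).count i = β i := by
  have hcount : List.count i ∘ (fun j => List.replicate (β j) j) =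
      fun j => if j = i then β j else 0 := by
    ext j
    simp [List.count_replicate]
  rw [multiIndexList, List.count_flatMap, hcount, ← List.ofFn_eq_map, List.sum_ofFn]
  simp

lemma pairwise_multiIndexList (β : Fin d → ℕ) : (multiIndexList β).Pairwise (· ≤ ·) := by
  rw [multiIndexList, List.pairwise_flatMap]
  refine ⟨fun i _ => by simp [List.pairwise_replicate], (List.pairwise_lt_finRange d).imp ?_⟩
  intro a b hab x hx y hy
  rw [List.eq_of_mem_replicate hx, List.eq_of_mem_replicate hy]
  exact hab.le

lemma multiIndexList_count_of_sublist {β : Fin d → ℕ} {w : List (Fin d)}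
    (h : w.Sublist (multiIndexList β)) : multiIndexList (fun i => w.count i) = w :=
  List.Perm.eq_of_pairwise' (pairwise_multiIndexList _) ((pairwise_multiIndexList β).sublist h)
    (List.perm_iff_count.2 (count_multiIndexList _))

end MultiIndexList

section Jet

variable {d : ℕ} {γ : Fin d → ℕ∞} {f g : (Fin d → ℝ) → ℝ}

/-- The space of families of continuous functions on `ℝ^d` indexed by the multiindices `β ≤ γ`. With
its product topology, convergence is locally uniform convergence of every entry. -/
abbrev JetSpace (γ : Fin d → ℕ∞) : Type :=
  {β : Fin d → ℕ // ∀ i, (β i : ℕ∞) ≤ γ i} → C(Fin d → ℝ, ℝ)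

lemma isCMulti_of_contDiff (hf : ContDiff ℝ ∞ f) (γ : Fin d → ℕ∞) : IsCMulti γ f := fun _ _ =>
  ⟨partialDerivListExists_of_contDiff hf _, (contDiff_partialDerivList hf _).continuous⟩

lemma contDiff_bump_convolution (φ : ContDiffBump (0 : Fin d → ℝ)) (hf : Continuous f) :
    ContDiff ℝ ∞ (φ.normed volume ⋆ f) :=
  φ.hasCompactSupport_normed.contDiff_convolution_left _ φ.contDiff_normed hf.locallyIntegrable

lemma contDiff_continuousMap_convolution (k : C(Fin d → ℝ, ℝ)) (hs : HasCompactSupport g)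
    (hg : ContDiff ℝ ∞ g) : ContDiff ℝ ∞ (k ⋆ g) :=
  hs.contDiff_convolution_right _ k.continuous.locallyIntegrable hg

namespace IsCMulti

/-- The family of all derivatives `∂^β f`, `β ≤ γ`, of a function `f` of class `C^γ`. -/
noncomputable def jet (hf : IsCMulti γ f) : JetSpace γ :=
  fun β => ⟨multiPartialDeriv β f, (hf β β.2).2⟩

lemma jet_congr (h : f = g) (hf : IsCMulti γ f) (hg : IsCMulti γ g) : hf.jet = hg.jet := by
  subst h
  rfl

lemma continuous (hf : IsCMulti γ f) : Continuous f := by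
  have hnil : multiIndexList (0 : Fin d → ℕ) = [] := by simp [multiIndexList]
  simpa only [multiPartialDeriv, hnil, partialDerivList] using (hf 0 (by simp)).2

lemma continuous_partialDerivList_of_suffix (hf : IsCMulti γ f) {β : Fin d → ℕ}
    (hβ : ∀ i, (β i : ℕ∞) ≤ γ i) {w : List (Fin d)} (hw : w <:+ multiIndexList β) :
    Continuous (partialDerivList f w) := by
  have hle (i : Fin d) : (w.count i : ℕ∞) ≤ γ i :=
    (Nat.cast_le.2 ((hw.sublist.count_le i).trans_eq (count_multiIndexList β i))).trans (hβ i)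
  simpa only [multiPartialDeriv, multiIndexList_count_of_sublist hw.sublist] using (hf _ hle).2

lemma multiPartialDeriv_convolution (hg : IsCMulti γ g) (hs : HasCompactSupport f)
    (hf : Continuous f) {β : Fin d → ℕ} (hβ : ∀ i, (β i : ℕ∞) ≤ γ i) :
    multiPartialDeriv β (f ⋆ g) = f ⋆ multiPartialDeriv β g :=
  partialDerivList_convolution_of_hasCompactSupport_left hs hf _ (hg β hβ).1
    fun _ => hg.continuous_partialDerivList_of_suffix hβ

lemma tendsto_jet_bump_convolution (hf : IsCMulti γ f) {ι : Type*} {l : Filter ι}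
    {φ : ι → ContDiffBump (0 : Fin d → ℝ)} (hφ : Tendsto (fun n => (φ n).rOut) l (𝓝 0)) :
    Tendsto (fun n => (isCMulti_of_contDiff (contDiff_bump_convolution (φ n) hf.continuous) γ).jet)
      l (𝓝 hf.jet) := by
  refine tendsto_pi_nhds.2 fun β => tendsto_continuousMap_of_tendsto_prod_nhds fun x => ?_
  have hcont := (hf β β.2).2
  simp only [jet, ContinuousMap.coe_mk, hf.multiPartialDeriv_convolution
    (φ _).hasCompactSupport_normed (φ _).continuous_normed β.2]
  exact ContDiffBump.convolution_tendsto_right (hφ.comp tendsto_fst)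
    (.of_forall fun _ => hcont.aestronglyMeasurable) ((hcont.tendsto x).comp tendsto_snd)
    tendsto_snd

lemma tendsto_jet_of_eventuallyEq (hf : IsCMulti γ f) {ι : Type*} {l : Filter ι}
    {F : ι → (Fin d → ℝ) → ℝ} (h : ∀ n, IsCMulti γ (F n))
    (hF : ∀ x, ∀ᶠ p : ι × (Fin d → ℝ) in l ×ˢ 𝓝 x, F p.1 =ᶠ[𝓝 p.2] f) :
    Tendsto (fun n => (h n).jet) l (𝓝 hf.jet) := by
  refine tendsto_pi_nhds.2 fun β => tendsto_continuousMap_of_tendsto_prod_nhds fun x => ?_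
  refine ((((hf β β.2).2.tendsto x).comp tendsto_snd).congr' ?_)
  filter_upwards [hF x] with p hp
  exact (partialDerivList_eventuallyEq hp _).eq_of_nhds.symm

lemma continuous_jet_convolution (hs : HasCompactSupport g) (hg : ContDiff ℝ ∞ g) :
    Continuous fun k : C(Fin d → ℝ, ℝ) =>
      (isCMulti_of_contDiff (contDiff_continuousMap_convolution k hs hg) γ).jet := by
  refine continuous_pi fun β => ContinuousMap.continuous_of_continuous_uncurry _ ?_
  have hderiv (k : C(Fin d → ℝ, ℝ)) : multiPartialDeriv β (k ⋆ g) = k ⋆ multiPartialDeriv β g :=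
    partialDerivList_convolution_of_hasCompactSupport_right k.continuous.locallyIntegrable hs hg _
  simp only [jet, hderiv]
  exact continuous_convolution_apply _ (hasCompactSupport_partialDerivList hs hg _)
    (contDiff_partialDerivList hg _).continuous

end IsCMulti

/-- The jets of the polynomials with rational coefficients. -/
def ratPolyJets (γ : Fin d → ℕ∞) : Set (JetSpace γ) :=
  range fun q : MvPolynomial (Fin d) ℚ => (isCMulti_of_contDiff (contDiff_aeval q) γ).jet

lemma jet_aeval_mem_closure_ratPolyJets (p : MvPolynomial (Fin d) ℝ) :
    (isCMulti_of_contDiff (contDiff_aeval p) γ).jet ∈ closure (ratPolyJets γ) := by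
  let J : MvPolynomial (Fin d) ℝ →ₗ[ℝ] JetSpace γ :=
    .pi fun β => mvPolynomialToContinuousMap.toLinearMap ∘ₗ pderivList (multiIndexList β)
  have hJ (r : MvPolynomial (Fin d) ℝ) :
      J r = (isCMulti_of_contDiff (contDiff_aeval r) γ).jet := by
    ext β x
    change mvPolynomialToContinuousMap (pderivList _ r) x =
      partialDerivList (fun y => aeval y r) _ x
    rw [mvPolynomialToContinuousMap_apply, partialDerivList_aeval]
  rw [← hJ]
  refine closure_mono ?_ (map_mem_closure_range_map_rat J p)
  rintro _ ⟨q, rfl⟩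
  refine ⟨q, ?_⟩
  beta_reduce
  rw [hJ]
  exact IsCMulti.jet_congr (funext fun x => (aeval_map_algebraMap ℝ x q).symm) _ _

lemma jet_convolution_mem_closure_ratPolyJets (k : C(Fin d → ℝ, ℝ)) (hs : HasCompactSupport g)
    (hg : ContDiff ℝ ∞ g) :
    (isCMulti_of_contDiff (contDiff_continuousMap_convolution k hs hg) γ).jet ∈
      closure (ratPolyJets γ) := by
  rw [← closure_closure]
  refine map_mem_closure (IsCMulti.continuous_jet_convolution hs hg)
    (dense_range_mvPolynomialToContinuousMap k) ?_
  rintro _ ⟨p, rfl⟩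
  obtain ⟨r, hr⟩ := exists_aeval_eq_convolution p hs hg.continuous
  have hpr : ⇑(mvPolynomialToContinuousMap p) ⋆ g = fun x => aeval x r := by
    rw [← hr, ← funext (mvPolynomialToContinuousMap_apply p)]
  beta_reduce
  rw [IsCMulti.jet_congr hpr _ (isCMulti_of_contDiff (contDiff_aeval r) γ)]
  exact jet_aeval_mem_closure_ratPolyJets r

lemma exists_seq_contDiffBump_tendsto_rOut_zero (E : Type*) [NormedAddCommGroup E] :
    ∃ φ : ℕ → ContDiffBump (0 : E), Tendsto (fun n => (φ n).rOut) atTop (𝓝 0) :=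
  ⟨fun n => ⟨1 / (n + 1 : ℝ) / 2, 1 / (n + 1 : ℝ), by positivity, half_lt_self (by positivity)⟩,
    tendsto_one_div_add_atTop_nhds_zero_nat⟩

lemma jet_mem_closure_ratPolyJets_of_hasCompactSupport (hs : HasCompactSupport f)
    (hf : ContDiff ℝ ∞ f) :
    (isCMulti_of_contDiff hf γ).jet ∈ closure (ratPolyJets γ) := by
  obtain ⟨φ, hφ⟩ := exists_seq_contDiffBump_tendsto_rOut_zero (Fin d → ℝ)
  refine isClosed_closure.mem_of_tendsto
    ((isCMulti_of_contDiff hf γ).tendsto_jet_bump_convolution hφ) (.of_forall fun n => ?_)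
  exact jet_convolution_mem_closure_ratPolyJets ⟨_, (φ n).continuous_normed⟩ hs hf

lemma jet_mem_closure_ratPolyJets_of_contDiff (hf : ContDiff ℝ ∞ f) :
    (isCMulti_of_contDiff hf γ).jet ∈ closure (ratPolyJets γ) := by
  let χ (n : ℕ) : ContDiffBump (0 : Fin d → ℝ) := ⟨n + 1, n + 2, by positivity, by simp⟩
  have hχf (n : ℕ) : ContDiff ℝ ∞ (⇑(χ n) * f) := (χ n).contDiff.mul hf
  have hcutoff (x : Fin d → ℝ) :
      ∀ᶠ p : ℕ × (Fin d → ℝ) in atTop ×ˢ 𝓝 x, ⇑(χ p.1) * f =ᶠ[𝓝 p.2] f := by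
    obtain ⟨N, hN⟩ := exists_nat_ge ‖x‖
    have hball : ball (0 : Fin d → ℝ) (N + 1) ∈ 𝓝 x :=
      isOpen_ball.mem_nhds (mem_ball_zero_iff.2 (by linarith))
    filter_upwards [prod_mem_prod (Ici_mem_atTop N) hball] with ⟨n, y⟩ ⟨hn, hy⟩
    have hle : (N : ℝ) + 1 ≤ n + 1 := by gcongr; exact hn
    filter_upwards [(χ n).eventuallyEq_one_of_mem_ball (ball_subset_ball hle hy)] with z hz
    simp [hz]
  refine isClosed_closure.mem_of_tendsto ((isCMulti_of_contDiff hf γ).tendsto_jet_of_eventuallyEq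
    (fun n => isCMulti_of_contDiff (hχf n) γ) hcutoff) (.of_forall fun n => ?_)
  exact jet_mem_closure_ratPolyJets_of_hasCompactSupport (χ n).hasCompactSupport.mul_right (hχf n)

theorem IsCMulti.jet_mem_closure_ratPolyJets (hf : IsCMulti γ f) :
    hf.jet ∈ closure (ratPolyJets γ) := by
  obtain ⟨φ, hφ⟩ := exists_seq_contDiffBump_tendsto_rOut_zero (Fin d → ℝ)
  exact isClosed_closure.mem_of_tendsto (hf.tendsto_jet_bump_convolution hφ)
    (.of_forall fun n => jet_mem_closure_ratPolyJets_of_contDiff <|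
      contDiff_bump_convolution (φ n) hf.continuous)

theorem IsCMulti.exists_seq_ratPolyFun_tendstoLocallyUniformly (hf : IsCMulti γ f) :
    ∃ q : ℕ → MvPolynomial (Fin d) ℚ, ∀ β : Fin d → ℕ, (∀ i, (β i : ℕ∞) ≤ γ i) →
      TendstoLocallyUniformly (fun n => multiPartialDeriv β (ratPolyFun (q n)))
        (multiPartialDeriv β f) atTop := by
  obtain ⟨J, hJ, hlim⟩ := mem_closure_iff_seq_limit.1 hf.jet_mem_closure_ratPolyJets
  choose q hq using hJ
  refine ⟨q, fun β hβ => ?_⟩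
  have hβlim := tendsto_pi_nhds.1 hlim ⟨β, hβ⟩
  simp only [← hq] at hβlim
  exact ContinuousMap.tendsto_iff_tendstoLocallyUniformly.1 hβlim

end Jet

theorem theorem6p10 (d : ℕ) :
    (∀ (γ : Fin d → ℕ∞) (f : (Fin d → ℝ) → ℝ), IsCMulti γ f →
      ∃ q : ℕ → MvPolynomial (Fin d) ℚ,
        ∀ β : Fin d → ℕ, (∀ i, (β i : ℕ∞) ≤ γ i) →
          TendstoLocallyUniformly (fun n => multiPartialDeriv β (ratPolyFun (q n)))
            (multiPartialDeriv β f) atTop) ∧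
    (∀ f : (Fin d → ℝ) → ℝ, ContDiff ℝ ∞ f →
      ∃ q : ℕ → MvPolynomial (Fin d) ℚ,
        ∀ (K : Set (Fin d → ℝ)), IsCompact K → ∀ β : Fin d → ℕ,
          TendstoUniformlyOn (fun n => multiPartialDeriv β (ratPolyFun (q n)))
            (multiPartialDeriv β f) atTop K) := by
  refine ⟨fun γ f hf => hf.exists_seq_ratPolyFun_tendstoLocallyUniformly, fun f hf => ?_⟩
  obtain ⟨q, hq⟩ := (isCMulti_of_contDiff hf ⊤).exists_seq_ratPolyFun_tendstoLocallyUniformly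
  exact ⟨q, fun K hK β =>
    tendstoLocallyUniformly_iff_forall_isCompact.1 (hq β fun _ => le_top) K hK⟩
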